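/- Let $\mathbb K\in\{\mathbb R,\mathbb C\}$ and equip $\mathbb K^n$ with the scalar product $\langle x,y\rangle=y^*x$. A linear relation in $\mathbb K^n$ is a linear subspace $\mathcal M\subseteq\mathbb K^n\times\mathbb K^n$. It is called dissipative if $\operatorname{Re}\langle x,y\rangle\le 0$ for all $(x,y)\in\mathcal M$; maximally dissipative if it is dissipative and not a proper subspace of a dissipative linear relation; and nonnegative if it is symmetric, i.e. $\langle w,x\rangle=\langle v,y\rangle$ for all $(v,w),(x,y)\in\mathcal M$, and $\langle x,y\rangle\ge 0$ for all $(x,y)\in\mathcal M$. The product of two linear relations is $\mathcal D\mathcal L=\{(x,z) : \exists y,\ (x,y)\in\mathcal L,\ (y,z)\in\mathcal D\}$, and for $L\in\mathbb K^{n\times n}$ we write $(\operatorname{gr}L)^{-1}=\{(Lx,x): x\in\mathbb K^n\}$. A pencil $sE-A$ with $E,A\in\mathbb K^{n\times n}$ is regular if $\det(sE-A)$ is not the zero polynomial. Its spectrum $\sigma(E,A)$ is the set of all $\lambda\in\mathbb C$ with $\operatorname{rank}_{\mathbb C}(\lambda E-A)<\operatorname{rank}_{\mathbb K(s)}(sE-A)$.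 A regular pencil has a Weierstrass form over $\mathbb C$: there are invertible $S,T\in\mathbb C^{n\times n}$ with $S(sE-A)T=\operatorname{diag}(sI-J,\ sN-I)$, where $J$ is in Jordan canonical form and $N$ is block diagonal with nilpotent Jordan blocks. The sizes of the Jordan blocks of $J$ at $\lambda\in\mathbb C$ are called the sizes of the Jordan blocks of $sE-A$ at $\lambda$, and those of the blocks of $N$ the sizes of its Jordan blocks at $\infty$; they do not depend on the choice of $S,T$. An eigenvalue $\lambda$ is semi-simple if no Jordan block at $\lambda$ has size two or more. The index of $sE-A$ is the largest size of a Jordan block at $\infty$ ($0$ if there is none). **Proposition.** Let $E,A\in\mathbb K^{n\times n}$ be such that $$\operatorname{ran}\begin{bmatrix}E\\A\end{bmatrix}=\{(Ez,Az): z\in\mathbb K^n\}=\mathcal D\mathcal L$$ for some dissipative linear relation $\mathcal D$ and some nonnegative linear relation $\mathcal L$ in $\mathbb K^n$, and let $sE-A$ be regular. Then: (a) Every $\lambda\in\sigma(E,A)$ satisfies $\operatorname{Re}\lambda\le 0$; the non-zero eigenvalues on the imaginary axis are semi-simple; and the Jordan blocks at $0$ have size at most two. (b) The Jordan blocks at $\infty$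 have size at most three, i.e. the index of $sE-A$ is at most three. (c) If additionally $\mathcal D$ is maximally dissipative and $\mathcal L=(\operatorname{gr}L)^{-1}$ for some (Hermitian) positive definite $L\in\mathbb K^{n\times n}$, then the index of $sE-A$ is at most one and, if $0$ is an eigenvalue, it is semi-simple. -/

import Mathlib

open scoped ComplexOrder

/-! ### Linear relations in `𝕂ⁿ` -/

/-- A linear relation in `𝕂ⁿ`: a linear subspace of `𝕂ⁿ × 𝕂ⁿ`. -/
abbrev LinRel (𝕂 : Type*) [RCLike 𝕂] (n : ℕ) : Type _ :=
  Submodule 𝕂 ((Fin n → 𝕂) × (Fin n → 𝕂))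

namespace LinRel

variable {𝕂 : Type*} [RCLike 𝕂] {n : ℕ}

/-- The standard scalar product `⟨x, y⟩ = y^* x` on `𝕂ⁿ`. -/
def sp (x y : Fin n → 𝕂) : 𝕂 := star y ⬝ᵥ x

/-- The product `M L = {(x, z) | ∃ y, (x, y) ∈ L ∧ (y, z) ∈ M}`. -/
def prod (M L : LinRel 𝕂 n) : LinRel 𝕂 n where
  carrier := {p | ∃ y, (p.1, y) ∈ L ∧ (y, p.2) ∈ M}
  add_mem' := by
    rintro p q ⟨y, h1, h2⟩ ⟨y', h1', h2'⟩
    exact ⟨y + y', L.add_mem h1 h1', M.add_mem h2 h2'⟩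
  zero_mem' := ⟨0, L.zero_mem, M.zero_mem⟩
  smul_mem' := by
    rintro c p ⟨y, h1, h2⟩
    exact ⟨c • y, L.smul_mem c h1, M.smul_mem c h2⟩

/-- The inverse `M⁻¹ = {(y, x) | (x, y) ∈ M}`. -/
def inverse (M : LinRel 𝕂 n) : LinRel 𝕂 n where
  carrier := {p | (p.2, p.1) ∈ M}
  add_mem' := fun h1 h2 => M.add_mem h1 h2
  zero_mem' := M.zero_mem
  smul_mem' := fun c _ h => M.smul_mem c h

/-- The adjoint `M^* = {(x, y) | ⟨w, x⟩ = ⟨v, y⟩ for all (v, w) ∈ M}`. -/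
def adjoint (M : LinRel 𝕂 n) : LinRel 𝕂 n where
  carrier := {p | ∀ v w, (v, w) ∈ M → sp w p.1 = sp v p.2}
  add_mem' := by
    intro p q hp hq v w h
    have h1 := hp v w h
    have h2 := hq v w h
    simp only [sp] at h1 h2
    simp [sp, h1, h2]
  zero_mem' := by
    intro v w _
    simp [sp]
  smul_mem' := by
    intro c p hp v w h
    have h1 := hp v w h
    simp only [sp] at h1
    simp [sp, h1]

/-- The graph `{(x, M x) | x ∈ 𝕂ⁿ}` of a square matrix. -/
def gr (M : Matrix (Fin n) (Fin n) 𝕂) : LinRel 𝕂 n := M.mulVecLin.graph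

/-- The range `{(E z, A z) | z ∈ 𝕂ⁿ}` of the block column `[E; A]`. -/
def ranPair (E A : Matrix (Fin n) (Fin n) 𝕂) : LinRel 𝕂 n :=
  LinearMap.range (E.mulVecLin.prod A.mulVecLin)

/-- `M` is symmetric if `M ⊆ M^*`. -/
def IsSymmetric (M : LinRel 𝕂 n) : Prop := M ≤ M.adjoint

/-- `M` is dissipative if `Re ⟨x, y⟩ ≤ 0` for all `(x, y) ∈ M`. -/
def IsDissipative (M : LinRel 𝕂 n) : Prop :=
  ∀ x y, (x, y) ∈ M → RCLike.re (sp x y) ≤ 0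

/-- `M` is nonnegative if it is symmetric and `⟨x, y⟩ ≥ 0` (in particular real) for all
`(x, y) ∈ M`. -/
def IsNonneg (M : LinRel 𝕂 n) : Prop :=
  M.IsSymmetric ∧ ∀ x y, (x, y) ∈ M → 0 ≤ sp x y

/-- `M` is maximally dissipative if it is dissipative and not a proper subspace of a dissipative
linear relation. -/
def IsMaxDissipative (M : LinRel 𝕂 n) : Prop :=
  M.IsDissipative ∧ ∀ N : LinRel 𝕂 n, N.IsDissipative → ¬ M < N

end LinRel

/-! ### Matrix pencils `s E - A` -/

namespace Pencil

variable {𝕂 : Type*} [RCLike 𝕂] {n : ℕ}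

/-- The pencil `s E - A` is regular if `det (s E - A)` is not the zero polynomial. -/
def IsRegular (E A : Matrix (Fin n) (Fin n) 𝕂) : Prop :=
  ((Polynomial.X : Polynomial 𝕂) • E.map Polynomial.C - A.map Polynomial.C).det ≠ 0

/-- A matrix over `𝕂` (the real or complex numbers), regarded as a complex matrix. -/
noncomputable def toComplex (M : Matrix (Fin n) (Fin n) 𝕂) : Matrix (Fin n) (Fin n) ℂ :=
  M.map (RCLike.map 𝕂 ℂ)

/-- The set `σ(E, A)` of the eigenvalues of `s E - A`: all complex numbers `μ` such that the rank of
`μ E - A` over `ℂ` is smaller than the rank of `s E - A` over the field `𝕂(s)` of rational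
functions. -/
def spectrum (E A : Matrix (Fin n) (Fin n) 𝕂) : Set ℂ :=
  {μ | (μ • toComplex E - toComplex A).rank <
    ((RatFunc.X : RatFunc 𝕂) • E.map RatFunc.C - A.map RatFunc.C).rank}

/-- The `k × k` Jordan block with eigenvalue `μ`. -/
def jordanBlock (k : ℕ) (μ : ℂ) : Matrix (Fin k) (Fin k) ℂ :=
  Matrix.of fun i j => if i = j then μ else if (i : ℕ) + 1 = j then 1 else 0

/-- A Weierstrass form, i.e. a Kronecker form without row and column minimal indices, of the complex
pencil `s E - A`: invertible `S`, `T` with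
`S (s E - A) T = diag (s I - J, s N - I)`, where `J` is block diagonal with Jordan blocks of sizes
`finSize i` at the eigenvalues `eig i`, and `N` is block diagonal with nilpotent Jordan blocks of
sizes `infSize j`.  The bijection `e` orders the rows and columns of the block matrix. -/
structure WeierstrassForm (E A : Matrix (Fin n) (Fin n) ℂ) where
  numFin : ℕ
  finSize : Fin numFin → ℕ
  finSize_pos : ∀ i, 0 < finSize i
  eig : Fin numFin → ℂ
  numInf : ℕ
  infSize : Fin numInf → ℕ
  infSize_pos : ∀ j, 0 < infSize j
  e : ((Σ i, Fin (finSize i)) ⊕ (Σ j, Fin (infSize j))) ≃ Fin n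
  S : Matrix (Fin n) (Fin n) ℂ
  T : Matrix (Fin n) (Fin n) ℂ
  isUnit_S : IsUnit S
  isUnit_T : IsUnit T
  leading : S * E * T = Matrix.reindex e e
    (Matrix.fromBlocks 1 0 0 (Matrix.blockDiagonal' fun j => jordanBlock (infSize j) 0))
  constant : S * A * T = Matrix.reindex e e
    (Matrix.fromBlocks (Matrix.blockDiagonal' fun i => jordanBlock (finSize i) (eig i)) 0 0 1)

/-- `k` is the size of a Jordan block of `s E - A` at `μ ∈ ℂ`.  (The block sizes do not depend on the
chosen Weierstrass form; for real pencils, they are those of the complexified pencil.) -/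
def HasJordanBlock (E A : Matrix (Fin n) (Fin n) 𝕂) (μ : ℂ) (k : ℕ) : Prop :=
  ∃ W : WeierstrassForm (toComplex E) (toComplex A), ∃ i, W.eig i = μ ∧ W.finSize i = k

/-- `k` is the size of a Jordan block of `s E - A` at `∞`. -/
def HasJordanBlockAtInfinity (E A : Matrix (Fin n) (Fin n) 𝕂) (k : ℕ) : Prop :=
  ∃ W : WeierstrassForm (toComplex E) (toComplex A), ∃ j, W.infSize j = k

/-- An eigenvalue `μ` of `s E - A` is semi-simple if there is no Jordan block of size at least two
at `μ`. -/
def IsSemisimple (E A : Matrix (Fin n) (Fin n) 𝕂) (μ : ℂ) : Prop :=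
  ∀ k, 2 ≤ k → ¬ HasJordanBlock E A μ k

/-- The index of a regular pencil: the largest size of a Jordan block at `∞`, and `0` if there is no
such block. -/
noncomputable def index (E A : Matrix (Fin n) (Fin n) 𝕂) : ℕ :=
  sSup {k | HasJordanBlockAtInfinity E A k}

/-- The supremum in the definition of the index is over a bounded set. -/
theorem bddAbove_jordanBlockAtInfinity (E A : Matrix (Fin n) (Fin n) 𝕂) :
    BddAbove {k | HasJordanBlockAtInfinity E A k} := by
  refine ⟨n, ?_⟩
  rintro k ⟨W, j, rfl⟩
  have h : Function.Injective
      (fun x : Fin (W.infSize j) => W.e (Sum.inr ⟨j, x⟩)) := by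
    intro x y hxy
    simpa using hxy
  simpa using Fintype.card_le_of_injective _ h

end Pencil

namespace LinRel

variable {n : ℕ}

section Form

variable {𝕂 : Type*} [RCLike 𝕂]

theorem sp_add_left (x x' y : Fin n → 𝕂) : sp (x + x') y = sp x y + sp x' y := by
  simp [sp]

theorem sp_add_right (x y y' : Fin n → 𝕂) : sp x (y + y') = sp x y + sp x y' := by
  simp [sp]

theorem sp_smul_left (c : 𝕂) (x y : Fin n → 𝕂) : sp (c • x) y = c * sp x y := by
  simp [sp]

theorem sp_smul_right (c : 𝕂) (x y : Fin n → 𝕂) : sp x (c • y) = star c * sp x y := by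
  simp [sp]

theorem sp_zero_left (y : Fin n → 𝕂) : sp 0 y = 0 := by simp [sp]

theorem sp_zero_right (x : Fin n → 𝕂) : sp x 0 = 0 := by simp [sp]

theorem star_sp (x y : Fin n → 𝕂) : star (sp x y) = sp y x := by
  rw [sp, sp, Matrix.star_dotProduct, star_star]

theorem sp_comm_eq_zero {x y : Fin n → 𝕂} (h : sp x y = 0) : sp y x = 0 := by
  rw [← star_sp, h, star_zero]

theorem sp_self_eq_zero {x : Fin n → 𝕂} (h : sp x x = 0) : x = 0 :=
  dotProduct_star_self_eq_zero.mp h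

theorem eq_zero_of_forall_re_star_mul_le {b : 𝕂} {r : ℝ}
    (h : ∀ c : 𝕂, r + RCLike.re (star c * b) ≤ 0) : b = 0 := by
  by_contra hb
  have hpos : 0 < ‖b‖ ^ 2 := by positivity
  have key := h ((((1 - r) / ‖b‖ ^ 2 : ℝ) : 𝕂) * b)
  have e : star ((((1 - r) / ‖b‖ ^ 2 : ℝ) : 𝕂) * b) * b = ((1 - r : ℝ) : 𝕂) := by
    rw [star_mul', mul_assoc, RCLike.star_def, RCLike.conj_mul,
      RCLike.conj_ofReal, ← RCLike.ofReal_pow, ← RCLike.ofReal_mul, div_mul_cancel₀ _ hpos.ne']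
  rw [e, RCLike.ofReal_re] at key
  linarith

/-- Polarization: an isotropic pair of a dissipative relation is orthogonal, with respect to the
polarized form, to the whole relation. -/
theorem IsDissipative.sp_add_sp_eq_zero {M : LinRel 𝕂 n} (hM : M.IsDissipative)
    {x y u v : Fin n → 𝕂} (hxy : (x, y) ∈ M) (h0 : RCLike.re (sp x y) = 0) (huv : (u, v) ∈ M) :
    sp u y + sp v x = 0 := by
  apply eq_zero_of_forall_re_star_mul_le (r := RCLike.re (sp u v))
  intro c
  have h := hM _ _ (M.add_mem huv (M.smul_mem c hxy))
  have e1 : RCLike.re (c * sp x v) = RCLike.re (star c * sp v x) := by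
    rw [← star_sp v x, ← star_star c, ← star_mul', star_star]
    simp
  have e2 : RCLike.re (star c * (c * sp x y)) = 0 := by
    rw [← mul_assoc, RCLike.star_def, RCLike.conj_mul, ← RCLike.ofReal_pow, RCLike.re_ofReal_mul,
      h0, mul_zero]
  simp only [Prod.smul_fst, Prod.smul_snd, sp_add_left, sp_add_right, sp_smul_left, sp_smul_right,
    map_add] at h
  rw [e1, mul_add, map_add, e2] at h
  rw [mul_add, map_add]
  linarith

/-- Cauchy–Schwarz: an isotropic pair of a nonnegative relation is orthogonal to the domain
and to the range. -/
theorem IsNonneg.sp_eq_zero {M : LinRel 𝕂 n} (hM : M.IsNonneg)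
    {x y u v : Fin n → 𝕂} (hxy : (x, y) ∈ M) (h0 : sp x y = 0) (huv : (u, v) ∈ M) :
    sp u y = 0 ∧ sp v x = 0 := by
  have hs : sp v x = sp u y := hM.1 hxy u v huv
  have : (-2 : 𝕂) * sp u y = 0 := by
    apply eq_zero_of_forall_re_star_mul_le (r := -RCLike.re (sp u v))
    intro c
    have h := (RCLike.le_iff_re_im.mp (hM.2 _ _ (M.add_mem huv (M.smul_mem c hxy)))).1
    have e1 : RCLike.re (c * sp x v) = RCLike.re (star c * sp u y) := by
      rw [← star_sp v x, hs, ← star_star c, ← star_mul', star_star]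
      simp
    simp only [Prod.smul_fst, Prod.smul_snd, sp_add_left, sp_add_right, sp_smul_left, sp_smul_right,
      map_add, map_zero, h0, mul_zero, add_zero] at h
    rw [e1] at h
    rw [show star c * (-2 * sp u y) = -(star c * sp u y + star c * sp u y) by ring, map_neg,
      map_add]
    linarith
  have h0 : sp u y = 0 := by simpa using this
  exact ⟨h0, hs.trans h0⟩

end Form

section Chains

variable {E A : Matrix (Fin n) (Fin n) ℂ} {D L : LinRel ℂ n}

theorem exists_of_ranPair_eq (hran : ranPair E A = D.prod L) (z : Fin n → ℂ) :
    ∃ y, (E.mulVec z, y) ∈ L ∧ (y, A.mulVec z) ∈ D := by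
  have h : (E.mulVec z, A.mulVec z) ∈ ranPair E A := ⟨z, rfl⟩
  rw [hran] at h
  exact h

theorem exists_mulVec_eq (hran : ranPair E A = D.prod L) {x y w : Fin n → ℂ}
    (h1 : (x, y) ∈ L) (h2 : (y, w) ∈ D) : ∃ z, E.mulVec z = x ∧ A.mulVec z = w := by
  have h : (x, w) ∈ D.prod L := ⟨y, h1, h2⟩
  rw [← hran] at h
  obtain ⟨z, hz⟩ := h
  exact ⟨z, congrArg Prod.fst hz, congrArg Prod.snd hz⟩

variable {s : ℂ}

theorem eq_zero_of_mulVec_eq_zero (hs : IsUnit (s • E - A)) {z : Fin n → ℂ}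
    (h : s • E.mulVec z = A.mulVec z) : z = 0 := by
  apply Matrix.mulVec_injective_iff_isUnit.mpr hs
  rw [Matrix.sub_mulVec, Matrix.smul_mulVec, h, sub_self, Matrix.mulVec_zero]

theorem eq_zero_of_mem_ranPair (hs : IsUnit (s • E - A)) {x z w : Fin n → ℂ}
    (hz : E.mulVec z = x ∧ A.mulVec z = 0) (hw : E.mulVec w = 0 ∧ A.mulVec w = x) : x = 0 := by
  have h : z + s • w = 0 := by
    apply eq_zero_of_mulVec_eq_zero hs
    simp [Matrix.mulVec_add, Matrix.mulVec_smul, hz, hw]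
  have h2 := congrArg E.mulVec h
  simpa [Matrix.mulVec_add, Matrix.mulVec_smul, hz, hw] using h2

theorem eq_zero_of_orthogonal (hs : IsUnit (s • E - A)) {y : Fin n → ℂ}
    (h : ∀ z, sp (E.mulVec z) y = 0 ∧ sp (A.mulVec z) y = 0) : y = 0 := by
  obtain ⟨z, hz⟩ := Matrix.mulVec_surjective_iff_isUnit.mpr hs y
  apply sp_self_eq_zero
  nth_rw 1 [← hz]
  rw [Matrix.sub_mulVec, Matrix.smul_mulVec, sub_eq_add_neg, ← neg_one_smul ℂ (A.mulVec z),
    sp_add_left, sp_smul_left, sp_smul_left, (h z).1, (h z).2]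
  simp

/-- A pair of `D` that is isotropic and decouples from `L` has first component zero, since it would
otherwise be orthogonal to the range of the regular pencil. -/
theorem eq_zero_of_decoupled (hD : D.IsDissipative) (hran : ranPair E A = D.prod L)
    (hs : IsUnit (s • E - A)) {x y : Fin n → ℂ} (hyx : (y, x) ∈ D)
    (hy : ∀ p r, (p, r) ∈ L → sp p y = 0) (hx : ∀ p r, (p, r) ∈ L → sp r x = 0)
    (h0 : (sp y x).re = 0) : y = 0 := by
  apply eq_zero_of_orthogonal hs
  intro z
  obtain ⟨r, h1, h2⟩ := exists_of_ranPair_eq hran z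
  refine ⟨hy _ _ h1, ?_⟩
  have h := hD.sp_add_sp_eq_zero hyx h0 h2
  rwa [hx _ _ h1, zero_add] at h

/-- For an eigenvector `z` at a nonzero eigenvalue and any intermediate vector `y` of
`(E z, A z) ∈ D L`, the energy `⟨E z, y⟩` does not vanish. -/
theorem sp_ne_zero_of_eigenvector (hD : D.IsDissipative) (hL : L.IsNonneg)
    (hran : ranPair E A = D.prod L) (hs : IsUnit (s • E - A)) {z y : Fin n → ℂ} {μ : ℂ}
    (hz : z ≠ 0) (hμ : μ ≠ 0) (hA : A.mulVec z = μ • E.mulVec z)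
    (h1 : (E.mulVec z, y) ∈ L) (h2 : (y, A.mulVec z) ∈ D) : sp (E.mulVec z) y ≠ 0 := by
  intro h0
  rw [hA] at h2
  have hy : y = 0 := by
    refine eq_zero_of_decoupled hD hran hs h2 (fun p r h => (hL.sp_eq_zero h1 h0 h).1)
      (fun p r h => ?_) ?_
    · rw [sp_smul_right, (hL.sp_eq_zero h1 h0 h).2, mul_zero]
    · rw [sp_smul_right, sp_comm_eq_zero h0, mul_zero, Complex.zero_re]
  subst hy
  obtain ⟨w, hw⟩ := exists_mulVec_eq hran L.zero_mem h2
  have hx : E.mulVec z = 0 := by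
    apply eq_zero_of_mem_ranPair hs (z := z - w) (w := μ⁻¹ • w)
    · simp [Matrix.mulVec_sub, hw, hA]
    · simp [Matrix.mulVec_smul, hw, hμ]
  apply hz
  apply eq_zero_of_mulVec_eq_zero hs
  rw [hA, hx, smul_zero, smul_zero]

theorem re_nonpos_of_eigenvector (hD : D.IsDissipative) (hL : L.IsNonneg)
    (hran : ranPair E A = D.prod L) (hs : IsUnit (s • E - A)) {z : Fin n → ℂ} {μ : ℂ}
    (hz : z ≠ 0) (hA : A.mulVec z = μ • E.mulVec z) : μ.re ≤ 0 := by
  by_cases hμ : μ = 0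
  · simp [hμ]
  obtain ⟨y, h1, h2⟩ := exists_of_ranPair_eq hran z
  have hne := sp_ne_zero_of_eigenvector hD hL hran hs hz hμ hA h1 h2
  have hnn := hL.2 _ _ h1
  have hd : (sp y (A.mulVec z)).re ≤ 0 := hD _ _ h2
  rw [hA, sp_smul_right, ← star_sp (E.mulVec z) y] at hd
  obtain ⟨h3, h4⟩ := Complex.le_def.mp hnn
  have h5 : (0 : ℝ) < (sp (E.mulVec z) y).re :=
    lt_of_le_of_ne h3 fun h => hne (Complex.ext h.symm h4.symm)
  have h6 : (sp (E.mulVec z) y).im = 0 := h4.symm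
  simp [h6] at hd
  nlinarith

theorem false_of_imaginary_chain (hD : D.IsDissipative) (hL : L.IsNonneg)
    (hran : ranPair E A = D.prod L) (hs : IsUnit (s • E - A)) {z₀ z₁ : Fin n → ℂ} {μ : ℂ}
    (hz : z₀ ≠ 0) (hμ : μ ≠ 0) (hre : μ.re = 0) (h₀ : A.mulVec z₀ = μ • E.mulVec z₀)
    (h₁ : A.mulVec z₁ = μ • E.mulVec z₁ + E.mulVec z₀) : False := by
  obtain ⟨y₀, hl₀, hd₀⟩ := exists_of_ranPair_eq hran z₀
  obtain ⟨y₁, hl₁, hd₁⟩ := exists_of_ranPair_eq hran z₁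
  have hne := sp_ne_zero_of_eigenvector hD hL hran hs hz hμ h₀ hl₀ hd₀
  have him : (sp (E.mulVec z₀) y₀).im = 0 := (Complex.le_def.mp (hL.2 _ _ hl₀)).2.symm
  have hstar : star μ + μ = 0 := by
    apply Complex.ext <;> simp [hre]
  rw [h₀] at hd₀
  rw [h₁] at hd₁
  have h := hD.sp_add_sp_eq_zero hd₀ (by
    rw [sp_smul_right, ← star_sp]
    simp [hre, him]) hd₁
  have hsym : sp y₁ (E.mulVec z₀) = sp (E.mulVec z₁) y₀ := hL.1 hl₀ _ _ hl₁
  rw [sp_smul_right, sp_add_left, sp_smul_left, hsym, ← add_assoc, ← add_mul, hstar, zero_mul,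
    zero_add] at h
  exact hne h

theorem false_of_zero_chain (hD : D.IsDissipative) (hL : L.IsNonneg)
    (hran : ranPair E A = D.prod L) (hs : IsUnit (s • E - A)) {z₀ z₁ z₂ : Fin n → ℂ}
    (hz : z₀ ≠ 0) (h₀ : A.mulVec z₀ = 0) (h₁ : A.mulVec z₁ = E.mulVec z₀)
    (h₂ : A.mulVec z₂ = E.mulVec z₁) : False := by
  obtain ⟨y₀, hl₀, hd₀⟩ := exists_of_ranPair_eq hran z₀
  obtain ⟨y₁, hl₁, hd₁⟩ := exists_of_ranPair_eq hran z₁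
  obtain ⟨y₂, hl₂, hd₂⟩ := exists_of_ranPair_eq hran z₂
  rw [h₀] at hd₀
  rw [h₁] at hd₁
  rw [h₂] at hd₂
  have hy₀ {u v : Fin n → ℂ} (h : (u, v) ∈ D) : sp v y₀ = 0 := by
    simpa [sp_zero_right] using hD.sp_add_sp_eq_zero hd₀ (by simp [sp_zero_right]) h
  have hL₀ {p r : Fin n → ℂ} (h : (p, r) ∈ L) := hL.sp_eq_zero hl₀ (hy₀ hd₁) h
  have hd : (sp y₁ (E.mulVec z₀)).re = 0 := by rw [(hL₀ hl₁).2, Complex.zero_re]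
  have h11 : sp (E.mulVec z₁) y₁ = 0 := by
    simpa [(hL₀ hl₂).2] using hD.sp_add_sp_eq_zero hd₁ hd hd₂
  have hy₁ : y₁ = 0 := eq_zero_of_decoupled hD hran hs hd₁
    (fun p r h => (hL.sp_eq_zero hl₁ h11 h).1) (fun p r h => (hL₀ h).2) hd
  subst hy₁
  obtain ⟨w, hw⟩ := exists_mulVec_eq hran L.zero_mem hd₁
  have hx := eq_zero_of_mem_ranPair hs ⟨rfl, h₀⟩ hw
  exact hz (eq_zero_of_mulVec_eq_zero hs (by rw [h₀, hx, smul_zero]))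

theorem false_of_infinite_chain (hD : D.IsDissipative) (hL : L.IsNonneg)
    (hran : ranPair E A = D.prod L) (hs : IsUnit (s • E - A)) {z₀ z₁ z₂ z₃ : Fin n → ℂ}
    (hz : z₀ ≠ 0) (h₀ : E.mulVec z₀ = 0) (h₁ : E.mulVec z₁ = A.mulVec z₀)
    (h₂ : E.mulVec z₂ = A.mulVec z₁) (h₃ : E.mulVec z₃ = A.mulVec z₂) : False := by
  obtain ⟨y₀, hl₀, hd₀⟩ := exists_of_ranPair_eq hran z₀
  obtain ⟨y₁, hl₁, hd₁⟩ := exists_of_ranPair_eq hran z₁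
  obtain ⟨y₂, hl₂, hd₂⟩ := exists_of_ranPair_eq hran z₂
  obtain ⟨y₃, hl₃, -⟩ := exists_of_ranPair_eq hran z₃
  rw [h₀] at hl₀
  rw [h₁] at hl₁
  rw [h₂] at hl₂
  rw [h₃] at hl₃
  have hL₀ {p r : Fin n → ℂ} (h : (p, r) ∈ L) : sp p y₀ = 0 :=
    (hL.sp_eq_zero hl₀ (sp_zero_left _) h).1
  have hre₀ : (sp y₀ (A.mulVec z₀)).re = 0 := by
    rw [sp_comm_eq_zero (hL₀ hl₁), Complex.zero_re]
  have h01 : sp (A.mulVec z₀) y₁ = 0 := by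
    apply sp_comm_eq_zero
    simpa [hL₀ hl₂] using hD.sp_add_sp_eq_zero hd₀ hre₀ hd₁
  have hL₁ {p r : Fin n → ℂ} (h : (p, r) ∈ L) := hL.sp_eq_zero hl₁ h01 h
  have hre₁ : (sp y₁ (A.mulVec z₁)).re = 0 := by
    rw [sp_comm_eq_zero (hL₁ hl₂).1, Complex.zero_re]
  have h12 : sp (A.mulVec z₁) y₂ = 0 := by
    apply sp_comm_eq_zero
    simpa [(hL₁ hl₃).1] using hD.sp_add_sp_eq_zero hd₁ hre₁ hd₂
  have hy₀ : y₀ = 0 := eq_zero_of_decoupled hD hran hs hd₀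
    (fun p r h => hL₀ h) (fun p r h => (hL₁ h).2) hre₀
  have hy₁ : y₁ = 0 := eq_zero_of_decoupled hD hran hs hd₁
    (fun p r h => (hL₁ h).1) (fun p r h => (hL.sp_eq_zero hl₂ h12 h).2) hre₁
  subst hy₀ hy₁
  have hx := eq_zero_of_mem_ranPair hs (exists_mulVec_eq hran hl₁ D.zero_mem).choose_spec
    (exists_mulVec_eq hran L.zero_mem hd₀).choose_spec
  exact hz (eq_zero_of_mulVec_eq_zero hs (by rw [h₀, hx, smul_zero]))

theorem false_of_definite_infinite_chain (hD : D.IsDissipative)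
    (hdef : ∀ x y, (x, y) ∈ L → sp x y = 0 → x = 0 ∧ y = 0)
    (hran : ranPair E A = D.prod L) (hs : IsUnit (s • E - A)) {z₀ z₁ : Fin n → ℂ}
    (hz : z₀ ≠ 0) (h₀ : E.mulVec z₀ = 0) (h₁ : E.mulVec z₁ = A.mulVec z₀) : False := by
  obtain ⟨y₀, hl₀, hd₀⟩ := exists_of_ranPair_eq hran z₀
  obtain ⟨y₁, hl₁, hd₁⟩ := exists_of_ranPair_eq hran z₁
  rw [h₀] at hl₀
  rw [h₁] at hl₁
  obtain rfl := (hdef _ _ hl₀ (sp_zero_left _)).2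
  have h := hD.sp_add_sp_eq_zero hd₀ (by simp [sp_zero_left]) hd₁
  rw [sp_zero_right, add_zero] at h
  have hx := (hdef _ _ hl₁ (sp_comm_eq_zero h)).1
  exact hz (eq_zero_of_mulVec_eq_zero hs (by rw [h₀, hx, smul_zero]))

theorem false_of_definite_zero_chain (hD : D.IsDissipative)
    (hdef : ∀ x y, (x, y) ∈ L → sp x y = 0 → x = 0 ∧ y = 0)
    (hran : ranPair E A = D.prod L) (hs : IsUnit (s • E - A)) {z₀ z₁ : Fin n → ℂ}
    (hz : z₀ ≠ 0) (h₀ : A.mulVec z₀ = 0) (h₁ : A.mulVec z₁ = E.mulVec z₀) : False := by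
  obtain ⟨y₀, hl₀, hd₀⟩ := exists_of_ranPair_eq hran z₀
  obtain ⟨y₁, -, hd₁⟩ := exists_of_ranPair_eq hran z₁
  rw [h₀] at hd₀
  rw [h₁] at hd₁
  have h := hD.sp_add_sp_eq_zero hd₀ (by simp [sp_zero_right]) hd₁
  rw [sp_zero_right, zero_add] at h
  have hx := (hdef _ _ hl₀ h).1
  exact hz (eq_zero_of_mulVec_eq_zero hs (by rw [h₀, hx, smul_zero]))

end Chains

end LinRel

/-- The canonical embedding of the real or complex numbers into `ℂ`. -/
noncomputable def complexEmbedding (𝕂 : Type*) [RCLike 𝕂] : 𝕂 →+* ℂ where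
  toFun := RCLike.map 𝕂 ℂ
  map_zero' := map_zero _
  map_add' := map_add _
  map_one' := by simp
  map_mul' x y := by apply Complex.ext <;> simp

namespace Pencil

variable {𝕂 : Type*} [RCLike 𝕂] {n : ℕ}

theorem IsRegular.exists_isUnit {E A : Matrix (Fin n) (Fin n) 𝕂} (h : IsRegular E A) :
    ∃ s : ℂ, IsUnit (s • toComplex E - toComplex A) := by
  obtain ⟨t, ht⟩ : ∃ t : 𝕂, (t • E - A).det ≠ 0 := by
    by_contra! hc
    apply h
    apply Polynomial.funext
    intro t
    rw [Polynomial.eval_zero, ← hc t, ← Polynomial.coe_evalRingHom, RingHom.map_det]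
    congr 1
    ext i j
    simp
    ring
  refine ⟨complexEmbedding 𝕂 t, (Matrix.isUnit_iff_isUnit_det _).mpr (isUnit_iff_ne_zero.mpr ?_)⟩
  have e : complexEmbedding 𝕂 t • toComplex E - toComplex A =
      (complexEmbedding 𝕂).mapMatrix (t • E - A) := by
    ext i j
    change complexEmbedding 𝕂 t * complexEmbedding 𝕂 (E i j) - complexEmbedding 𝕂 (A i j) =
      complexEmbedding 𝕂 (t * E i j - A i j)
    rw [map_sub, map_mul]
  rw [e, ← RingHom.map_det]
  exact (map_ne_zero _).mpr ht

theorem exists_eigenvector {E A : Matrix (Fin n) (Fin n) 𝕂} {μ : ℂ} (h : μ ∈ spectrum E A) :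
    ∃ z ≠ 0, (toComplex A).mulVec z = μ • (toComplex E).mulVec z := by
  have hlt : (μ • toComplex E - toComplex A).rank < n :=
    lt_of_lt_of_le h ((Matrix.rank_le_width _).trans le_rfl)
  have hdet : (μ • toComplex E - toComplex A).det = 0 := by
    by_contra hne
    have hu := (Matrix.isUnit_iff_isUnit_det _).mpr (isUnit_iff_ne_zero.mpr hne)
    rw [Matrix.rank_of_isUnit _ hu, Fintype.card_fin] at hlt
    exact hlt.false
  obtain ⟨z, hz, h0⟩ := Matrix.exists_mulVec_eq_zero_iff.mpr hdet
  refine ⟨z, hz, ?_⟩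
  rw [Matrix.sub_mulVec, Matrix.smul_mulVec, sub_eq_zero] at h0
  exact h0.symm

namespace WeierstrassForm

variable {E A : Matrix (Fin n) (Fin n) ℂ} (W : WeierstrassForm E A)

theorem mulVec_S_injective : Function.Injective W.S.mulVec :=
  Matrix.mulVec_injective_iff_isUnit.mpr W.isUnit_S

/-- The column of `T` with a given block index. -/
noncomputable def col (x : (Σ i, Fin (W.finSize i)) ⊕ (Σ j, Fin (W.infSize j))) : Fin n → ℂ :=
  W.T.col (W.e x)

theorem col_ne_zero (x : (Σ i, Fin (W.finSize i)) ⊕ (Σ j, Fin (W.infSize j))) :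
    W.col x ≠ 0 := by
  intro h
  have h' : W.T.mulVec (Pi.single (W.e x) 1) = W.T.mulVec 0 := by
    rw [Matrix.mulVec_single_one, Matrix.mulVec_zero]
    exact h
  have := Matrix.mulVec_injective_iff_isUnit.mpr W.isUnit_T h'
  simpa using congrFun this (W.e x)

theorem S_mulVec_col (M : Matrix (Fin n) (Fin n) ℂ)
    (x : (Σ i, Fin (W.finSize i)) ⊕ (Σ j, Fin (W.infSize j))) :
    W.S.mulVec (M.mulVec (W.col x)) = (W.S * M * W.T).col (W.e x) := by
  rw [col, ← Matrix.mulVec_single_one, ← Matrix.mulVec_single_one]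
  simp only [Matrix.mulVec_mulVec, Matrix.mul_assoc]

theorem mulVec_eq_of_forall {v w : Fin n → ℂ}
    (h : ∀ y, W.S.mulVec v (W.e y) = W.S.mulVec w (W.e y)) : v = w := by
  apply W.mulVec_S_injective
  funext k
  simpa using h (W.e.symm k)

theorem mulVec_col_inl_zero (i : Fin W.numFin) (h : 0 < W.finSize i) :
    A.mulVec (W.col (.inl ⟨i, ⟨0, h⟩⟩)) = W.eig i • E.mulVec (W.col (.inl ⟨i, ⟨0, h⟩⟩)) := by
  apply W.mulVec_eq_of_forall
  intro y
  rw [Matrix.mulVec_smul, Pi.smul_apply, S_mulVec_col, S_mulVec_col, W.leading, W.constant]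
  rcases y with ⟨i', a⟩ | ⟨j, a⟩
  · by_cases hi : i' = i
    · subst hi
      simp [Matrix.blockDiagonal'_apply, jordanBlock, Matrix.one_apply]
    · simp [Matrix.blockDiagonal'_apply, hi]
  · simp

theorem mulVec_col_inl_succ (i : Fin W.numFin) (m : ℕ) (h : m + 1 < W.finSize i) :
    A.mulVec (W.col (.inl ⟨i, ⟨m + 1, h⟩⟩)) = W.eig i • E.mulVec (W.col (.inl ⟨i, ⟨m + 1, h⟩⟩)) +
      E.mulVec (W.col (.inl ⟨i, ⟨m, by omega⟩⟩)) := by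
  apply W.mulVec_eq_of_forall
  intro y
  rw [Matrix.mulVec_add, Matrix.mulVec_smul, Pi.add_apply, Pi.smul_apply, S_mulVec_col,
    S_mulVec_col, S_mulVec_col, W.leading, W.constant]
  rcases y with ⟨i', a⟩ | ⟨j, a⟩
  · by_cases hi : i' = i
    · subst hi
      by_cases h1 : (a : ℕ) = m + 1
      · simp [Matrix.blockDiagonal'_apply, jordanBlock, Matrix.one_apply, Fin.ext_iff, h1]
      · simp [Matrix.blockDiagonal'_apply, jordanBlock, Matrix.one_apply, Fin.ext_iff, h1]
    · simp [Matrix.blockDiagonal'_apply, hi]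
  · simp

theorem mulVec_col_inr_zero (j : Fin W.numInf) (h : 0 < W.infSize j) :
    E.mulVec (W.col (.inr ⟨j, ⟨0, h⟩⟩)) = 0 := by
  apply W.mulVec_eq_of_forall
  intro y
  rw [Matrix.mulVec_zero, S_mulVec_col, W.leading]
  rcases y with ⟨i, a⟩ | ⟨j', a⟩
  · simp
  · by_cases hj : j' = j
    · subst hj
      simp [Matrix.blockDiagonal'_apply, jordanBlock]
    · simp [Matrix.blockDiagonal'_apply, hj]

theorem mulVec_col_inr_succ (j : Fin W.numInf) (m : ℕ) (h : m + 1 < W.infSize j) :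
    E.mulVec (W.col (.inr ⟨j, ⟨m + 1, h⟩⟩)) = A.mulVec (W.col (.inr ⟨j, ⟨m, by omega⟩⟩)) := by
  apply W.mulVec_eq_of_forall
  intro y
  rw [S_mulVec_col, S_mulVec_col, W.leading, W.constant]
  rcases y with ⟨i, a⟩ | ⟨j', a⟩
  · simp
  · by_cases hj : j' = j
    · subst hj
      simp [Matrix.blockDiagonal'_apply, jordanBlock, Matrix.one_apply, Fin.ext_iff]
      omega
    · simp [Matrix.blockDiagonal'_apply, hj]

end WeierstrassForm

end Pencil

namespace LinRel

variable {𝕂 : Type*} [RCLike 𝕂] {n : ℕ}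

/-- Pairs of a nonnegative relation with vanishing scalar product are trivial. -/
def IsDefinite (M : LinRel 𝕂 n) : Prop :=
  ∀ x y, (x, y) ∈ M → sp x y = 0 → x = 0 ∧ y = 0

theorem isDefinite_gr_inverse {L : Matrix (Fin n) (Fin n) 𝕂} (hL : L.PosDef) :
    (gr L).inverse.IsDefinite := by
  intro x y h h0
  have hx : x = L.mulVec y := h
  subst hx
  have hy : y = 0 := by
    by_contra hy
    exact (hL.dotProduct_mulVec_pos hy).ne' h0
  exact ⟨by rw [hy, Matrix.mulVec_zero], hy⟩

section RealField

/-- The vector of real parts. -/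
def reVec (𝕂 : Type*) [RCLike 𝕂] (x : Fin n → ℂ) : Fin n → 𝕂 := fun i => ((x i).re : 𝕂)

/-- The vector of imaginary parts. -/
def imVec (𝕂 : Type*) [RCLike 𝕂] (x : Fin n → ℂ) : Fin n → 𝕂 := fun i => ((x i).im : 𝕂)

theorem reVec_add (x y : Fin n → ℂ) : reVec 𝕂 (x + y) = reVec 𝕂 x + reVec 𝕂 y := by
  ext; simp [reVec]

theorem imVec_add (x y : Fin n → ℂ) : imVec 𝕂 (x + y) = imVec 𝕂 x + imVec 𝕂 y := by
  ext; simp [imVec]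

theorem reVec_smul (c : ℂ) (x : Fin n → ℂ) :
    reVec 𝕂 (c • x) = (c.re : 𝕂) • reVec 𝕂 x + (-c.im : 𝕂) • imVec 𝕂 x := by
  ext; simp [reVec, imVec, sub_eq_add_neg]

theorem imVec_smul (c : ℂ) (x : Fin n → ℂ) :
    imVec 𝕂 (c • x) = (c.re : 𝕂) • imVec 𝕂 x + (c.im : 𝕂) • reVec 𝕂 x := by
  ext; simp [reVec, imVec]

theorem eq_zero_of_reVec_imVec {x : Fin n → ℂ} (h1 : reVec 𝕂 x = 0) (h2 : imVec 𝕂 x = 0) :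
    x = 0 := by
  funext i
  apply Complex.ext
  · simpa [reVec] using congrFun h1 i
  · simpa [imVec] using congrFun h2 i

theorem re_sp (x y : Fin n → ℂ) : (sp x y).re =
    RCLike.re (sp (reVec 𝕂 x) (reVec 𝕂 y)) + RCLike.re (sp (imVec 𝕂 x) (imVec 𝕂 y)) := by
  simp [sp, dotProduct, reVec, imVec, Finset.sum_add_distrib]

theorem im_sp (x y : Fin n → ℂ) : (sp x y).im =
    RCLike.re (sp (imVec 𝕂 x) (reVec 𝕂 y)) - RCLike.re (sp (reVec 𝕂 x) (imVec 𝕂 y)) := by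
  simp [sp, dotProduct, reVec, imVec, Finset.sum_add_distrib, sub_eq_add_neg]

/-- The complexification of a linear relation over the reals. -/
def complexify (M : LinRel 𝕂 n) : LinRel ℂ n where
  carrier := {p | (reVec 𝕂 p.1, reVec 𝕂 p.2) ∈ M ∧ (imVec 𝕂 p.1, imVec 𝕂 p.2) ∈ M}
  add_mem' := by
    rintro p q ⟨hp, hp'⟩ ⟨hq, hq'⟩
    exact ⟨by simpa [reVec_add] using M.add_mem hp hq, by simpa [imVec_add] using M.add_mem hp' hq'⟩
  zero_mem' := by
    have h1 : reVec 𝕂 (0 : Fin n → ℂ) = 0 := by ext; simp [reVec]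
    have h2 : imVec 𝕂 (0 : Fin n → ℂ) = 0 := by ext; simp [imVec]
    change (reVec 𝕂 0, reVec 𝕂 0) ∈ M ∧ (imVec 𝕂 0, imVec 𝕂 0) ∈ M
    rw [h1, h2]
    exact ⟨M.zero_mem, M.zero_mem⟩
  smul_mem' := by
    rintro c p ⟨hp, hp'⟩
    constructor
    · rw [Prod.smul_fst, Prod.smul_snd, reVec_smul, reVec_smul]
      exact M.add_mem (M.smul_mem (c.re : 𝕂) hp) (M.smul_mem (-c.im : 𝕂) hp')
    · rw [Prod.smul_fst, Prod.smul_snd, imVec_smul, imVec_smul]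
      exact M.add_mem (M.smul_mem (c.re : 𝕂) hp') (M.smul_mem (c.im : 𝕂) hp)

theorem mem_complexify {M : LinRel 𝕂 n} {x y : Fin n → ℂ} : (x, y) ∈ M.complexify ↔
    (reVec 𝕂 x, reVec 𝕂 y) ∈ M ∧ (imVec 𝕂 x, imVec 𝕂 y) ∈ M := Iff.rfl

theorem IsDissipative.complexify {M : LinRel 𝕂 n} (hM : M.IsDissipative) :
    M.complexify.IsDissipative := by
  rintro x y ⟨h1, h2⟩
  have e := re_sp (𝕂 := 𝕂) x y
  have h1 := hM _ _ h1
  have h2 := hM _ _ h2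
  change (sp x y).re ≤ 0
  rw [e]
  exact add_nonpos h1 h2

theorem IsNonneg.complexify {M : LinRel 𝕂 n} (hM : M.IsNonneg) : M.complexify.IsNonneg := by
  have hs : M.complexify.IsSymmetric := by
    rintro ⟨x, y⟩ ⟨h1, h2⟩ v w ⟨h3, h4⟩
    dsimp only at h1 h2 h3 h4 ⊢
    apply Complex.ext
    · rw [re_sp (𝕂 := 𝕂), re_sp (𝕂 := 𝕂), hM.1 h1 _ _ h3, hM.1 h2 _ _ h4]
    · rw [im_sp (𝕂 := 𝕂), im_sp (𝕂 := 𝕂), hM.1 h1 _ _ h4, hM.1 h2 _ _ h3]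
  refine ⟨hs, ?_⟩
  intro x y h
  have h0 : sp y x = sp x y := hs h _ _ h
  rw [← star_sp] at h0
  have him : (sp x y).im = 0 := Complex.conj_eq_iff_im.mp h0
  refine Complex.le_def.mpr ⟨?_, him.symm⟩
  rw [re_sp (𝕂 := 𝕂)]
  exact add_nonneg (RCLike.nonneg_iff.mp (hM.2 _ _ h.1)).1
    (RCLike.nonneg_iff.mp (hM.2 _ _ h.2)).1

theorem IsDefinite.complexify {M : LinRel 𝕂 n} (hM : M.IsNonneg) (hd : M.IsDefinite) :
    M.complexify.IsDefinite := by
  intro x y h h0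
  have e := re_sp (𝕂 := 𝕂) x y
  rw [h0, Complex.zero_re] at e
  obtain ⟨p1, q1⟩ := RCLike.nonneg_iff.mp (hM.2 _ _ h.1)
  obtain ⟨p2, q2⟩ := RCLike.nonneg_iff.mp (hM.2 _ _ h.2)
  have h1 := hd _ _ h.1 (RCLike.ext (by rw [map_zero]; linarith) (by rw [q1, map_zero]))
  have h2 := hd _ _ h.2 (RCLike.ext (by rw [map_zero]; linarith) (by rw [q2, map_zero]))
  exact ⟨eq_zero_of_reVec_imVec h1.1 h2.1, eq_zero_of_reVec_imVec h1.2 h2.2⟩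

/-- The vector with given real and imaginary parts. -/
noncomputable def ofReIm (a b : Fin n → 𝕂) : Fin n → ℂ :=
  fun i => ⟨RCLike.re (a i), RCLike.re (b i)⟩

theorem reVec_ofReIm (hI : (RCLike.I : 𝕂) = 0) (a b : Fin n → 𝕂) : reVec 𝕂 (ofReIm a b) = a := by
  ext i; apply RCLike.ext <;> simp [reVec, ofReIm, RCLike.im_eq_zero hI]

theorem imVec_ofReIm (hI : (RCLike.I : 𝕂) = 0) (a b : Fin n → 𝕂) : imVec 𝕂 (ofReIm a b) = b := by
  ext i; apply RCLike.ext <;> simp [imVec, ofReIm, RCLike.im_eq_zero hI]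

theorem complexify_prod (hI : (RCLike.I : 𝕂) = 0) (M N : LinRel 𝕂 n) :
    (M.prod N).complexify = M.complexify.prod N.complexify := by
  ext ⟨x, z⟩
  constructor
  · rintro ⟨⟨y, h1, h2⟩, ⟨y', h1', h2'⟩⟩
    refine ⟨ofReIm y y', ?_, ?_⟩ <;> rw [mem_complexify, reVec_ofReIm hI, imVec_ofReIm hI]
    exacts [⟨h1, h1'⟩, ⟨h2, h2'⟩]
  · rintro ⟨y, ⟨h1, h1'⟩, ⟨h2, h2'⟩⟩
    exact ⟨⟨_, h1, h2⟩, ⟨_, h1', h2'⟩⟩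

theorem reVec_toComplex_mulVec (hI : (RCLike.I : 𝕂) = 0) (M : Matrix (Fin n) (Fin n) 𝕂)
    (z : Fin n → ℂ) :
    reVec 𝕂 ((Pencil.toComplex M).mulVec z) = M.mulVec (reVec 𝕂 z) := by
  ext i
  apply RCLike.ext <;>
    simp [reVec, Matrix.mulVec, dotProduct, Pencil.toComplex, RCLike.im_eq_zero hI]

theorem imVec_toComplex_mulVec (hI : (RCLike.I : 𝕂) = 0) (M : Matrix (Fin n) (Fin n) 𝕂)
    (z : Fin n → ℂ) :
    imVec 𝕂 ((Pencil.toComplex M).mulVec z) = M.mulVec (imVec 𝕂 z) := by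
  ext i
  apply RCLike.ext <;>
    simp [imVec, Matrix.mulVec, dotProduct, Pencil.toComplex, RCLike.im_eq_zero hI]

theorem complexify_ranPair (hI : (RCLike.I : 𝕂) = 0) (E A : Matrix (Fin n) (Fin n) 𝕂) :
    (ranPair E A).complexify = ranPair (Pencil.toComplex E) (Pencil.toComplex A) := by
  ext ⟨x, y⟩
  rw [mem_complexify]
  constructor
  · rintro ⟨⟨a, ha⟩, ⟨b, hb⟩⟩
    have key (M : Matrix (Fin n) (Fin n) 𝕂) (u : Fin n → ℂ) (h1 : M.mulVec a = reVec 𝕂 u)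
        (h2 : M.mulVec b = imVec 𝕂 u) : (Pencil.toComplex M).mulVec (ofReIm a b) = u := by
      rw [← sub_eq_zero]
      apply eq_zero_of_reVec_imVec (𝕂 := 𝕂)
      · rw [sub_eq_add_neg, ← neg_one_smul ℂ u, reVec_add, reVec_toComplex_mulVec hI, reVec_smul,
          reVec_ofReIm hI, h1]
        simp
      · rw [sub_eq_add_neg, ← neg_one_smul ℂ u, imVec_add, imVec_toComplex_mulVec hI, imVec_smul,
          imVec_ofReIm hI, h2]
        simp
    exact ⟨ofReIm a b, Prod.ext (key E x (congrArg Prod.fst ha) (congrArg Prod.fst hb))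
      (key A y (congrArg Prod.snd ha) (congrArg Prod.snd hb))⟩
  · rintro ⟨z, hz⟩
    obtain ⟨rfl, rfl⟩ := Prod.ext_iff.mp hz
    exact ⟨⟨reVec 𝕂 z, Prod.ext (reVec_toComplex_mulVec hI E z).symm
        (reVec_toComplex_mulVec hI A z).symm⟩,
      ⟨imVec 𝕂 z, Prod.ext (imVec_toComplex_mulVec hI E z).symm
        (imVec_toComplex_mulVec hI A z).symm⟩⟩

end RealField

section ComplexField

variable (hI : RCLike.im (RCLike.I : 𝕂) = 1)

/-- Transport of a vector along the isomorphism `𝕂 ≃ ℂ`. -/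
noncomputable def ofComplexVec (x : Fin n → ℂ) : Fin n → 𝕂 :=
  fun i => (RCLike.complexRingEquiv hI).symm (x i)

theorem ofComplexVec_surjective (y : Fin n → 𝕂) : ∃ x, ofComplexVec hI x = y :=
  ⟨fun i => RCLike.complexRingEquiv hI (y i), by ext; simp [ofComplexVec]⟩

theorem ofComplexVec_injective : Function.Injective (ofComplexVec (n := n) hI) := by
  intro x y h
  funext i
  exact (RCLike.complexRingEquiv hI).symm.injective (congrFun h i)

theorem sp_ofComplexVec (x y : Fin n → ℂ) :
    sp (ofComplexVec hI x) (ofComplexVec hI y) = (RCLike.complexRingEquiv hI).symm (sp x y) := by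
  simp only [sp, dotProduct, map_sum, map_mul, ofComplexVec, Pi.star_apply]
  refine Finset.sum_congr rfl fun i _ => congrArg (· * _) ?_
  apply RCLike.ext <;> simp [hI]

theorem re_sp_ofComplexVec (x y : Fin n → ℂ) :
    RCLike.re (sp (ofComplexVec hI x) (ofComplexVec hI y)) = (sp x y).re := by
  rw [sp_ofComplexVec]
  simp

/-- Transport of a linear relation along the isomorphism `𝕂 ≃ ℂ`. -/
noncomputable def transport (M : LinRel 𝕂 n) : LinRel ℂ n where
  carrier := {p | (ofComplexVec hI p.1, ofComplexVec hI p.2) ∈ M}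
  add_mem' := by
    intro p q hp hq
    have e (x y : Fin n → ℂ) : ofComplexVec hI (x + y) = ofComplexVec hI x + ofComplexVec hI y := by
      ext; simp only [ofComplexVec, Pi.add_apply, map_add]
    simpa [e] using M.add_mem hp hq
  zero_mem' := by
    have e : ofComplexVec hI (0 : Fin n → ℂ) = 0 := by
      ext; simp only [ofComplexVec, Pi.zero_apply, map_zero]
    change (ofComplexVec hI 0, ofComplexVec hI 0) ∈ M
    rw [e]
    exact M.zero_mem
  smul_mem' := by
    intro c p hp
    have e (x : Fin n → ℂ) :
        ofComplexVec hI (c • x) = (RCLike.complexRingEquiv hI).symm c • ofComplexVec hI x := by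
      ext; simp only [ofComplexVec, Pi.smul_apply, smul_eq_mul, map_mul]
    change (ofComplexVec hI (c • p.1), ofComplexVec hI (c • p.2)) ∈ M
    rw [e, e]
    exact M.smul_mem ((RCLike.complexRingEquiv hI).symm c) hp

theorem mem_transport {M : LinRel 𝕂 n} {x y : Fin n → ℂ} :
    (x, y) ∈ M.transport hI ↔ (ofComplexVec hI x, ofComplexVec hI y) ∈ M := Iff.rfl

theorem IsDissipative.transport {M : LinRel 𝕂 n} (hM : M.IsDissipative) :
    (M.transport hI).IsDissipative := by
  intro x y h
  have h := hM _ _ h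
  rwa [re_sp_ofComplexVec] at h

theorem IsNonneg.transport {M : LinRel 𝕂 n} (hM : M.IsNonneg) : (M.transport hI).IsNonneg := by
  constructor
  · rintro ⟨x, y⟩ h v w h'
    have h := hM.1 h _ _ h'
    dsimp only at h
    rw [sp_ofComplexVec, sp_ofComplexVec] at h
    exact (RCLike.complexRingEquiv hI).symm.injective h
  · intro x y h
    have h := RCLike.nonneg_iff.mp (hM.2 _ _ h)
    rw [sp_ofComplexVec] at h
    exact RCLike.nonneg_iff.mpr (by simpa [hI] using h)

theorem IsDefinite.transport {M : LinRel 𝕂 n} (hM : M.IsDefinite) :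
    (M.transport hI).IsDefinite := by
  intro x y h h0
  have h := hM _ _ h (by rw [sp_ofComplexVec, h0, map_zero])
  have e : ofComplexVec hI (0 : Fin n → ℂ) = 0 := by
    ext; simp only [ofComplexVec, Pi.zero_apply, map_zero]
  rw [← e] at h
  exact ⟨ofComplexVec_injective hI h.1, ofComplexVec_injective hI h.2⟩

theorem transport_prod (M N : LinRel 𝕂 n) :
    (M.prod N).transport hI = (M.transport hI).prod (N.transport hI) := by
  ext ⟨x, z⟩
  constructor
  · rintro ⟨y, h1, h2⟩
    obtain ⟨y, rfl⟩ := ofComplexVec_surjective hI y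
    exact ⟨y, h1, h2⟩
  · rintro ⟨y, h1, h2⟩
    exact ⟨_, h1, h2⟩

theorem ofComplexVec_toComplex_mulVec (M : Matrix (Fin n) (Fin n) 𝕂) (z : Fin n → ℂ) :
    ofComplexVec hI ((Pencil.toComplex M).mulVec z) = M.mulVec (ofComplexVec hI z) := by
  ext i
  simp only [ofComplexVec, Matrix.mulVec, dotProduct, map_sum, map_mul]
  exact Finset.sum_congr rfl fun j _ =>
    congrArg (· * _) ((RCLike.complexRingEquiv hI).symm_apply_apply (M i j))

theorem transport_ranPair (E A : Matrix (Fin n) (Fin n) 𝕂) :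
    (ranPair E A).transport hI = ranPair (Pencil.toComplex E) (Pencil.toComplex A) := by
  ext ⟨x, y⟩
  rw [mem_transport]
  constructor
  · rintro ⟨a, ha⟩
    obtain ⟨a, rfl⟩ := ofComplexVec_surjective hI a
    refine ⟨a, Prod.ext (ofComplexVec_injective hI ?_) (ofComplexVec_injective hI ?_)⟩
    · exact (ofComplexVec_toComplex_mulVec hI E a).trans (congrArg Prod.fst ha)
    · exact (ofComplexVec_toComplex_mulVec hI A a).trans (congrArg Prod.snd ha)
  · rintro ⟨z, hz⟩
    obtain ⟨rfl, rfl⟩ := Prod.ext_iff.mp hz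
    exact ⟨ofComplexVec hI z, Prod.ext (ofComplexVec_toComplex_mulVec hI E z).symm
        (ofComplexVec_toComplex_mulVec hI A z).symm⟩

end ComplexField

theorem exists_complexification {E A : Matrix (Fin n) (Fin n) 𝕂} {𝒟 ℒ : LinRel 𝕂 n}
    (h𝒟 : 𝒟.IsDissipative) (hℒ : ℒ.IsNonneg) (hran : ranPair E A = 𝒟.prod ℒ) :
    ∃ D L : LinRel ℂ n, D.IsDissipative ∧ L.IsNonneg ∧
      ranPair (Pencil.toComplex E) (Pencil.toComplex A) = D.prod L ∧
      (ℒ.IsDefinite → L.IsDefinite) := by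
  obtain hI | hI := RCLike.I_eq_zero_or_im_I_eq_one (K := 𝕂)
  · refine ⟨_, _, h𝒟.complexify, hℒ.complexify, ?_, IsDefinite.complexify hℒ⟩
    rw [← complexify_ranPair hI, hran, complexify_prod hI]
  · refine ⟨_, _, h𝒟.transport hI, hℒ.transport hI, ?_, IsDefinite.transport hI⟩
    rw [← transport_ranPair hI, hran, transport_prod hI]

end LinRel

theorem proposition6p3 {𝕂 : Type*} [RCLike 𝕂] {n : ℕ}
    (E A : Matrix (Fin n) (Fin n) 𝕂) (𝒟 ℒ : LinRel 𝕂 n)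
    (h𝒟 : 𝒟.IsDissipative) (hℒ : ℒ.IsNonneg)
    (hran : LinRel.ranPair E A = 𝒟.prod ℒ)
    (hreg : Pencil.IsRegular E A) :
    ((∀ μ ∈ Pencil.spectrum E A, μ.re ≤ 0) ∧
      (∀ μ ∈ Pencil.spectrum E A, μ.re = 0 → μ ≠ 0 → Pencil.IsSemisimple E A μ) ∧
      (∀ k, Pencil.HasJordanBlock E A 0 k → k ≤ 2)) ∧
    Pencil.index E A ≤ 3 ∧
    (𝒟.IsMaxDissipative →
      (∃ L : Matrix (Fin n) (Fin n) 𝕂, L.PosDef ∧ ℒ = (LinRel.gr L).inverse) →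
      Pencil.index E A ≤ 1 ∧ Pencil.IsSemisimple E A 0) := by

  obtain ⟨s, hs⟩ := hreg.exists_isUnit
  obtain ⟨D, L, hD, hL, hr, hdef⟩ := LinRel.exists_complexification h𝒟 hℒ hran
  refine ⟨⟨?_, ?_, ?_⟩, ?_, ?_⟩
  · intro μ hμ
    obtain ⟨z, hz, hA⟩ := Pencil.exists_eigenvector hμ
    exact LinRel.re_nonpos_of_eigenvector hD hL hr hs hz hA
  · rintro μ - hre hμ k hk ⟨W, i, rfl, rfl⟩
    exact LinRel.false_of_imaginary_chain hD hL hr hs (W.col_ne_zero _) hμ hre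
      (W.mulVec_col_inl_zero i (by omega)) (W.mulVec_col_inl_succ i 0 (by omega))
  · rintro k ⟨W, i, hi, rfl⟩
    by_contra! hk
    have h₀ := W.mulVec_col_inl_zero i (by omega)
    have h₁ := W.mulVec_col_inl_succ i 0 (by omega)
    have h₂ := W.mulVec_col_inl_succ i 1 (by omega)
    rw [hi, zero_smul] at h₀
    rw [hi, zero_smul, zero_add (_ : Fin n → ℂ)] at h₁ h₂
    exact LinRel.false_of_zero_chain hD hL hr hs (W.col_ne_zero _) h₀ h₁ h₂
  · apply csSup_le'
    rintro k ⟨W, j, rfl⟩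
    by_contra! hk
    exact LinRel.false_of_infinite_chain hD hL hr hs (W.col_ne_zero _)
      (W.mulVec_col_inr_zero j (by omega)) (W.mulVec_col_inr_succ j 0 (by omega))
      (W.mulVec_col_inr_succ j 1 (by omega)) (W.mulVec_col_inr_succ j 2 (by omega))
  · rintro - ⟨Λ, hΛ, rfl⟩
    have hd := hdef (LinRel.isDefinite_gr_inverse hΛ)
    constructor
    · apply csSup_le'
      rintro k ⟨W, j, rfl⟩
      by_contra! hk
      exact LinRel.false_of_definite_infinite_chain hD hd hr hs (W.col_ne_zero _)
        (W.mulVec_col_inr_zero j (by omega)) (W.mulVec_col_inr_succ j 0 (by omega))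
    · rintro k hk ⟨W, i, hi, rfl⟩
      have h₀ := W.mulVec_col_inl_zero i (by omega)
      have h₁ := W.mulVec_col_inl_succ i 0 (by omega)
      rw [hi, zero_smul] at h₀
      rw [hi, zero_smul, zero_add (_ : Fin n → ℂ)] at h₁
      exact LinRel.false_of_definite_zero_chain hD hd hr hs (W.col_ne_zero _) h₀ h₁
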